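/- A *CFSM protocol* $\mathbf P$ consists of a finite directed graph $G=(N,E)$ (the communication graph; an edge $\xi$ has tail $-\xi$ and head $+\xi$, loops and multiple edges are allowed), pairwise disjoint finite message alphabets $M_\xi$ $(\xi\in E)$, and for every $j\in N$ a finite state machine $F_j=(K_j,\Sigma_j,T_j,h_j)$ with finite state set $K_j$, initial state $h_j\in K_j$, alphabet $\Sigma_j=\{+b : b\in M_\xi,\ j=+\xi\}\cup\{-b : b\in M_\xi,\ j=-\xi\}$ and transition set $T_j\subseteq K_j\times\Sigma_j\times K_j$. A *composite state* is a vector $S=(p_j)_{j\in N}$ with $p_j\in K_j$, a *channel content* is a vector $C=(x_\xi)_{\xi\in E}$ of strings $x_\xi\in M_\xi^*$, and a *global state* is a pair $(S,C)$. In one step, a machine $F_i$ makes a transition $(p_i,+b,q_i)\in T_i$ with $b\in M_\beta$, $i=+\beta$, and $b$ is removed from the front of $x_\beta$; or it makes a transition $(p_i,-b,q_i)\in T_i$ with $b\in M_\beta$, $i=-\beta$, and $b$ is appended at the end of $x_\beta$; all else is unchanged. A global state is *reachable* if it can be reached by finitely many (possibly zero) steps from $(S^0,C^0)$, where $S^0=(h_j)_{j\in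 N}$ and all strings in $C^0$ are empty. A composite state $S$ is *stable* if $(S,C^0)$ is reachable. A state $p\in K_j$ is a *receive state* if no transition $(p,-b,q)$ is in $T_j$; a global state $(S,C)$ is *deadlocked* if all states in $S$ are receive states and $C=C^0$; $\mathbf P$ is *deadlock-free* if no deadlocked global state is reachable. $\mathbf P$ has the *recognizable channel property* if for every composite state $S$ the relation $\mathbf L(S)=\{C : (S,C)\text{ is reachable}\}$ is a recognizable subset of the monoid $\prod_{\xi\in E}M_\xi^*$, i.e. the inverse image of a set under a homomorphism to a finite monoid. **Corollary 9.6.** The simple reachability problems (such as the deadlock problem) are algorithmically decidable for the CFSM protocols with the recognizable channel property, on arbitrary communication graphs. That is, for each of the following problems there is a single algorithm (partial recursive function) which, whenever it is given a finite description of a CFSM protocol $\mathbf P$ that has the recognizable channel property, together with the further data of the problem, halts with the correct answer: 1. given a global state $(S,C)$ of $\mathbf P$, is $(S,C)$ reachable? 2. given a composite state $S$ of $\mathbf P$, is $S$ stable? 3. is $\mathbf P$ deadlock-free? -/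

import Mathlib

universe u

namespace CFSM

/-- The alphabet `Σ_j` of the machine at the node `j`: the symbols `+b` with `b ∈ M ξ`, `j = +ξ`,
and the symbols `-b` with `b ∈ M ξ`, `j = -ξ`. Every symbol carries the edge `ξ` of its message,
so that the alphabets `M ξ` count as pairwise disjoint. -/
inductive Label {N E : Type u} (tail head : E → N) (M : E → Type u) (j : N) : Type u
  | recv (ξ : E) (h : head ξ = j) (b : M ξ) : Label tail head M j
  | send (ξ : E) (h : tail ξ = j) (b : M ξ) : Label tail head M j

/-- A CFSM protocol: a finite directed graph with node set `N` and edge set `E` (multiple edges and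
loops are allowed), finite message alphabets `M ξ`, and a finite state machine
`(K j, Σ_j, T j, home j)` at every node `j`. -/
structure Protocol where
  N : Type u
  E : Type u
  tail : E → N
  head : E → N
  M : E → Type u
  K : N → Type u
  home : ∀ j, K j
  T : ∀ j, Set (K j × Label tail head M j × K j)
  finite_N : Finite N
  finite_E : Finite E
  finite_M : ∀ ξ, Finite (M ξ)
  finite_K : ∀ j, Finite (K j)

namespace Protocol

variable (P : Protocol.{u})

/-- The alphabet `Σ_j`. -/
abbrev Sym (j : P.N) : Type u := Label P.tail P.head P.M j

abbrev CompositeState : Type u := ∀ j : P.N, P.K j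

abbrev ChannelContent : Type u := ∀ ξ : P.E, List (P.M ξ)

abbrev GlobalState : Type u := P.CompositeState × P.ChannelContent

/-- The content `C⁰` in which every channel is empty. -/
def emptyContent : P.ChannelContent := fun _ => []

/-- The initial global state `(S⁰, C⁰)`. -/
def init : P.GlobalState := (P.home, P.emptyContent)

/-- One step of the protocol: a message is received from the front of the channel `β` by the
machine at `+β`, or appended to the channel `β` by the machine at `-β`. -/
inductive Step : P.GlobalState → P.GlobalState → Prop
  | recv (S S' : P.CompositeState) (C C' : P.ChannelContent) (β : P.E) (b : P.M β)
      (machine : (S (P.head β), Label.recv β rfl b, S' (P.head β)) ∈ P.T (P.head β))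
      (others : ∀ j, j ≠ P.head β → S j = S' j)
      (otherChannels : ∀ ξ, ξ ≠ β → C ξ = C' ξ)
      (channel : C β = b :: C' β) : Step (S, C) (S', C')
  | send (S S' : P.CompositeState) (C C' : P.ChannelContent) (β : P.E) (b : P.M β)
      (machine : (S (P.tail β), Label.send β rfl b, S' (P.tail β)) ∈ P.T (P.tail β))
      (others : ∀ j, j ≠ P.tail β → S j = S' j)
      (otherChannels : ∀ ξ, ξ ≠ β → C ξ = C' ξ)
      (channel : C' β = C β ++ [b]) : Step (S, C) (S', C')

/-- A global state is reachable if it is reachable from the initial one. -/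
def Reachable (G : P.GlobalState) : Prop := Relation.ReflTransGen P.Step P.init G

/-- The composite state `S` is stable if `(S, C⁰)` is reachable. -/
def Stable (S : P.CompositeState) : Prop := P.Reachable (S, P.emptyContent)

/-- `p` is a receive state if no transition out of `p` sends a message. -/
def IsReceiveState {j : P.N} (p : P.K j) : Prop :=
  ∀ (ξ : P.E) (h : P.tail ξ = j) (b : P.M ξ) (q : P.K j), (p, Label.send ξ h b, q) ∉ P.T j

def Deadlocked (G : P.GlobalState) : Prop :=
  (∀ j, P.IsReceiveState (G.1 j)) ∧ G.2 = P.emptyContent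

def DeadlockFree : Prop := ∀ G, P.Reachable G → ¬ P.Deadlocked G

/-- The relation `L(S)` of all channel contents `C` such that `(S, C)` is reachable. -/
def channelRel (S : P.CompositeState) : Set P.ChannelContent := {C | P.Reachable (S, C)}

/-- A relation between strings over the alphabets `M ξ` is recognizable if it is the inverse image
of a set under a homomorphism from the product of the free monoids over the `M ξ` to a finite
monoid. -/
def Recognizable (L : Set P.ChannelContent) : Prop :=
  ∃ (F : Type) (_ : Monoid F) (_ : Finite F) (φ : (∀ ξ, FreeMonoid (P.M ξ)) →* F) (A : Set F),
    ∀ C : P.ChannelContent, C ∈ L ↔ φ (fun ξ => FreeMonoid.ofList (C ξ)) ∈ A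

def RecognizableChannelProperty : Prop := ∀ S, P.Recognizable (P.channelRel S)

/-- What it takes to write a protocol down: numberings of the nodes, the edges, the messages and the
states, and for each machine a list of its transitions (in any order, with or without
repetitions). -/
structure Presentation where
  numNodes : ℕ
  numEdges : ℕ
  numMessages : P.E → ℕ
  numStates : P.N → ℕ
  node : P.N ≃ Fin numNodes
  edge : P.E ≃ Fin numEdges
  message : ∀ ξ, P.M ξ ≃ Fin (numMessages ξ)
  state : ∀ j, P.K j ≃ Fin (numStates j)
  transitions : ∀ j, List (P.K j × P.Sym j × P.K j)
  mem_transitions : ∀ j t, t ∈ transitions j ↔ t ∈ P.T j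

end Protocol

/-- Descriptions of protocols by finite lists of natural numbers: for every node the number of
states, the initial state and the list of transitions `(p, (is it a send?, edge, message), q)` of
its machine; for every edge its tail, its head and the size of its message alphabet. -/
abbrev ProtocolCode : Type :=
  List (ℕ × ℕ × List (ℕ × (Bool × ℕ × ℕ) × ℕ)) × List (ℕ × ℕ × ℕ)

/-- The numbers of the states at the successive nodes. -/
abbrev CompositeStateCode : Type := List ℕ

/-- The numbers of the states at the successive nodes, and the strings of the numbers of the
messages in the successive channels. -/
abbrev GlobalStateCode : Type := CompositeStateCode × List (List ℕ)

namespace Protocol.Presentation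

variable {P : Protocol.{u}} (ν : P.Presentation)

def codeSym {j : P.N} : P.Sym j → Bool × ℕ × ℕ
  | .recv ξ _ b => (false, (ν.edge ξ : ℕ), (ν.message ξ b : ℕ))
  | .send ξ _ b => (true, (ν.edge ξ : ℕ), (ν.message ξ b : ℕ))

def codeMachine (j : P.N) : ℕ × ℕ × List (ℕ × (Bool × ℕ × ℕ) × ℕ) :=
  (ν.numStates j, (ν.state j (P.home j) : ℕ),
    (ν.transitions j).map fun t =>
      ((ν.state j t.1 : ℕ), ν.codeSym t.2.1, (ν.state j t.2.2 : ℕ)))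

def codeEdge (ξ : P.E) : ℕ × ℕ × ℕ :=
  ((ν.node (P.tail ξ) : ℕ), (ν.node (P.head ξ) : ℕ), ν.numMessages ξ)

/-- The description of the protocol that belongs to the presentation. -/
def code : ProtocolCode :=
  (List.ofFn fun i => ν.codeMachine (ν.node.symm i),
    List.ofFn fun i => ν.codeEdge (ν.edge.symm i))

def codeComposite (S : P.CompositeState) : CompositeStateCode :=
  List.ofFn fun i => (ν.state (ν.node.symm i) (S (ν.node.symm i)) : ℕ)

def codeGlobal (G : P.GlobalState) : GlobalStateCode :=
  (ν.codeComposite G.1,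
    List.ofFn fun i =>
      (G.2 (ν.edge.symm i)).map fun b => (ν.message (ν.edge.symm i) b : ℕ))

end Protocol.Presentation

instance Label.finite {N E : Type u} (tail head : E → N) (M : E → Type u) (j : N)
    [Finite E] [∀ ξ, Finite (M ξ)] : Finite (Label tail head M j) := by
  let f : Label tail head M j → Bool × (Σ ξ, M ξ) := fun
    | .recv ξ _ b => (false, ⟨ξ, b⟩)
    | .send ξ _ b => (true, ⟨ξ, b⟩)
  refine Finite.of_injective f ?_
  rintro (⟨ξ, h, b⟩ | ⟨ξ, h, b⟩) (⟨ξ', h', b'⟩ | ⟨ξ', h', b'⟩) hf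
  all_goals simp only [f, Prod.mk.injEq, Sigma.mk.injEq, reduceCtorEq, false_and, true_and] at hf
  all_goals
    obtain ⟨rfl, hb⟩ := hf
    obtain rfl := eq_of_heq hb
    rfl

/-- Every protocol can be written down. -/
theorem Protocol.nonempty_presentation (P : Protocol.{u}) : Nonempty P.Presentation := by
  have := P.finite_N
  have := P.finite_E
  have := P.finite_M
  have := P.finite_K
  obtain ⟨n, ⟨eN⟩⟩ := Finite.exists_equiv_fin P.N
  obtain ⟨m, ⟨eE⟩⟩ := Finite.exists_equiv_fin P.E
  choose k eM using fun ξ => Finite.exists_equiv_fin (P.M ξ)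
  choose s eK using fun j => Finite.exists_equiv_fin (P.K j)
  exact ⟨{
    numNodes := n
    numEdges := m
    numMessages := k
    numStates := s
    node := eN
    edge := eE
    message := fun ξ => (eM ξ).some
    state := fun j => (eK j).some
    transitions := fun j => (Set.toFinite (P.T j)).toFinset.toList
    mem_transitions := fun j t => by simp }⟩

end CFSM

/-! Each of the three problems asks whether some member of a finite, computable list of global
states is reachable. Two searches run in parallel. One enumerates the runs of the protocol and finds
a reachable member if there is one (`exists_mem_reachedIn`). The other enumerates finite
certificates of unreachability: a finite quotient of the monoid of channel contents, with a set of
pairs (composite state, class) that contains the initial pair, is closed under steps and misses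
every listed state.

A certificate is checked by a primitive recursive predicate, and for every protocol it bounds the
reachable states (`mem_states_of_reachable`), so an answer is never wrong. Recognizability
guarantees that the search halts. There are finitely many composite states, so the homomorphisms
recognizing the relations `L(S)` combine into one congruence of finite index that saturates them all
(`exists_quotient`). The pairs (S, class of C) with (S, C) reachable then describe the reachability
set exactly and form a certificate whenever no listed state is reachable (`exists_excludes`). -/

namespace CFSM

/-! ### Closure rules for primitive recursive functions and predicates. -/

section PrimrecComposition

variable {α β γ σ : Type*} [Primcodable α] [Primcodable β] [Primcodable γ] [Primcodable σ]

attribute [fun_prop] Primrec Primrec.const Primrec.id Primrec.comp Primrec.fst Primrec.snd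
  Primrec.pair Primrec.list_length Primrec.list_range Primrec.list_head? Primrec.list_tail Primrec.option_some

@[fun_prop]
theorem primrec_natPair {f g : α → ℕ} (hf : Primrec f) (hg : Primrec g) :
    Primrec fun a => Nat.pair (f a) (g a) := Primrec₂.natPair.comp hf hg

@[fun_prop]
theorem primrec_getD {f : α → List β} {g : α → ℕ} (d : β) (hf : Primrec f) (hg : Primrec g) :
    Primrec fun a => (f a).getD (g a) d := (Primrec.list_getD d).comp hf hg

@[fun_prop]
theorem primrec_getElem? {f : α → List β} {g : α → ℕ} (hf : Primrec f) (hg : Primrec g) :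
    Primrec fun a => (f a)[g a]? := Primrec.list_getElem?.comp hf hg

@[fun_prop]
theorem primrec_append {f g : α → List β} (hf : Primrec f) (hg : Primrec g) :
    Primrec fun a => f a ++ g a := Primrec.list_append.comp hf hg

@[fun_prop]
theorem primrec_cons {f : α → β} {g : α → List β} (hf : Primrec f) (hg : Primrec g) :
    Primrec fun a => f a :: g a := Primrec.list_cons.comp hf hg

@[fun_prop]
theorem primrec_set {f : α → List β} {g : α → ℕ} {h : α → β}
    (hf : Primrec f) (hg : Primrec g) (hh : Primrec h) :
    Primrec fun a => (f a).set (g a) (h a) := Primrec.list_set.comp hf (hg.pair hh)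

@[fun_prop]
theorem primrec_map {f : α → List β} {g : α → β → σ} (hf : Primrec f)
    (hg : Primrec fun q : α × β => g q.1 q.2) : Primrec fun a => (f a).map (g a) :=
  Primrec.list_map hf hg

@[fun_prop]
theorem primrec_flatMap {f : α → List β} {g : α → β → List σ} (hf : Primrec f)
    (hg : Primrec fun q : α × β => g q.1 q.2) : Primrec fun a => (f a).flatMap (g a) :=
  Primrec.list_flatMap hf hg

@[fun_prop]
theorem primrec_foldr {f : α → List β} {g : α → σ} {h : α → β → σ → σ} (hf : Primrec f)
    (hg : Primrec g) (hh : Primrec fun q : α × β × σ => h q.1 q.2.1 q.2.2) :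
    Primrec fun a => (f a).foldr (h a) (g a) :=
  Primrec.list_foldr (h := fun a p => h a p.1 p.2) hf hg hh

theorem primrecPred_eq {f g : α → β} (hf : Primrec f) (hg : Primrec g) :
    PrimrecPred fun a => f a = g a := Primrec.eq.comp hf hg

theorem primrecPred_lt {f g : α → ℕ} (hf : Primrec f) (hg : Primrec g) :
    PrimrecPred fun a => f a < g a := Primrec.nat_lt.comp hf hg

theorem primrecPred_forall_mem {f : α → List β} {p : α → β → Prop} (hf : Primrec f)
    (hp : PrimrecPred fun q : α × β => p q.1 q.2) : PrimrecPred fun a => ∀ b ∈ f a, p a b :=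
  (PrimrecRel.forall_mem_list (R := fun b a => p a b)
    (hp.comp (f := Prod.swap) (by unfold Prod.swap; fun_prop))).comp hf Primrec.id

theorem primrecPred_forall_lt {f : α → ℕ} {p : α → ℕ → Prop} (hf : Primrec f)
    (hp : PrimrecPred fun q : α × ℕ => p q.1 q.2) : PrimrecPred fun a => ∀ x < f a, p a x :=
  (primrecPred_forall_mem (Primrec.list_range.comp hf) hp).of_eq (by simp)

theorem primrecPred_exists_mem {f : α → List β} {p : α → β → Prop} (hf : Primrec f)
    (hp : PrimrecPred fun q : α × β => p q.1 q.2) : PrimrecPred fun a => ∃ b ∈ f a, p a b :=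
  (PrimrecRel.exists_mem_list (R := fun b a => p a b)
    (hp.comp (f := Prod.swap) (by unfold Prod.swap; fun_prop))).comp hf Primrec.id

theorem primrecPred_mem {f : α → β} {g : α → List β} (hf : Primrec f) (hg : Primrec g) :
    PrimrecPred fun a => f a ∈ g a :=
  (primrecPred_exists_mem (p := fun a b => b = f a) hg (primrecPred_eq (by fun_prop) (by fun_prop))).of_eq
    (by simp)

theorem primrecPred_imp {p q : α → Prop} (hp : PrimrecPred p) (hq : PrimrecPred q) :
    PrimrecPred fun a => p a → q a :=
  (hp.not.or hq).of_eq fun _ => imp_iff_not_or.symm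

end PrimrecComposition

/-! ### Runs of a protocol, computed on codes. -/

/-- A transition of a machine, preceded by the number of its node. -/
abbrev TransitionCode : Type := ℕ × ℕ × (Bool × ℕ × ℕ) × ℕ

namespace ProtocolCode

def transitions (c : ProtocolCode) : List TransitionCode :=
  (List.range c.1.length).flatMap fun j => (c.1.getD j (0, 0, [])).2.2.map fun t => (j, t)

/-- The pairs `(edge, message)`. -/
def letters (c : ProtocolCode) : List (ℕ × ℕ) :=
  (List.range c.2.length).flatMap fun e => (List.range (c.2.getD e (0, 0, 0)).2.2).map fun m => (e, m)

def initial (c : ProtocolCode) : GlobalStateCode :=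
  (c.1.map fun F => F.2.1, c.2.map fun _ => [])

/-- The result of firing a transition, if it is enabled. -/
def fire (g : GlobalStateCode) (t : TransitionCode) : List GlobalStateCode :=
  -- The entries of `t` are the node, the source state, the triple (is it a send?, edge, message)
  -- and the target state.
  if g.1[t.1]? = some t.2.1 then
    if t.2.2.1.1 = true then
      [(g.1.set t.1 t.2.2.2, g.2.set t.2.2.1.2.1 (g.2.getD t.2.2.1.2.1 [] ++ [t.2.2.1.2.2]))]
    else if (g.2.getD t.2.2.1.2.1 []).head? = some t.2.2.1.2.2 then
      [(g.1.set t.1 t.2.2.2, g.2.set t.2.2.1.2.1 (g.2.getD t.2.2.1.2.1 []).tail)]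
    else []
  else []

def successors (c : ProtocolCode) (l : List GlobalStateCode) : List GlobalStateCode :=
  l.flatMap fun g => c.transitions.flatMap (fire g)

/-- The global states that are reachable in exactly `n` steps. -/
def reachedIn (c : ProtocolCode) (n : ℕ) : List GlobalStateCode :=
  c.successors^[n] [c.initial]

/-- The composite states all of whose components are receive states. -/
def receiveComposites (c : ProtocolCode) : List CompositeStateCode :=
  c.1.foldr (fun F acc => acc.flatMap fun s => (List.range F.1).flatMap fun p =>
    if ∀ t ∈ F.2.2, t.1 = p → t.2.1.1 = false then [p :: s] else []) [[]]

def deadlocks (c : ProtocolCode) : List GlobalStateCode :=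
  c.receiveComposites.map fun s => (s, c.2.map fun _ => [])

@[fun_prop]
theorem primrec_transitions : Primrec transitions := by
  unfold transitions; fun_prop

@[fun_prop]
theorem primrec_letters : Primrec letters := by
  unfold letters; fun_prop

@[fun_prop]
theorem primrec_initial : Primrec initial := by
  unfold initial; fun_prop

@[fun_prop]
theorem primrec_fire {α : Type*} [Primcodable α] {f : α → GlobalStateCode}
    {g : α → TransitionCode} (hf : Primrec f) (hg : Primrec g) :
    Primrec fun a => fire (f a) (g a) := by
  unfold fire
  apply Primrec.ite
  · apply primrecPred_eq
    · fun_prop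
    · fun_prop
  · apply Primrec.ite
    · apply primrecPred_eq
      · fun_prop
      · fun_prop
    · fun_prop
    · apply Primrec.ite
      · apply primrecPred_eq
        · fun_prop
        · fun_prop
      · fun_prop
      · fun_prop
  · fun_prop

@[fun_prop]
theorem primrec_successors {α : Type*} [Primcodable α] {f : α → ProtocolCode}
    {g : α → List GlobalStateCode} (hf : Primrec f) (hg : Primrec g) :
    Primrec fun a => successors (f a) (g a) := by
  unfold successors; fun_prop

@[fun_prop]
theorem primrec_reachedIn {α : Type*} [Primcodable α] {f : α → ProtocolCode} {g : α → ℕ}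
    (hf : Primrec f) (hg : Primrec g) : Primrec fun a => reachedIn (f a) (g a) := by
  unfold reachedIn
  apply Primrec.nat_iterate hg
  · fun_prop
  · unfold Primrec₂; fun_prop

@[fun_prop]
theorem primrec_receiveComposites : Primrec receiveComposites := by
  unfold receiveComposites
  refine primrec_foldr (by fun_prop) (by fun_prop) (primrec_flatMap (by fun_prop)
    (primrec_flatMap (by fun_prop) (Primrec.ite ?_ (by fun_prop) (by fun_prop))))
  exact primrecPred_forall_mem (by fun_prop) (primrecPred_imp
    (primrecPred_eq (by fun_prop) (by fun_prop)) (primrecPred_eq (by fun_prop) (by fun_prop)))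

theorem primrec_deadlocks : Primrec deadlocks := by
  unfold deadlocks; fun_prop

end ProtocolCode

/-! ### Certificates of unreachability and their primitive recursive check. -/

/-- A finite quotient `{0, …, size - 1}` of the monoid of channel contents with a set of pairs of a
composite state and a class. The tables `left` and `right` give the product of a class with a
letter. -/
abbrev InvariantCode : Type := (ℕ × ℕ) × (List ℕ × List ℕ) × List (CompositeStateCode × ℕ)

namespace InvariantCode

def size (d : InvariantCode) : ℕ := d.1.1
def one (d : InvariantCode) : ℕ := d.1.2
-- Edge, message and class are paired into one index. The default value is harmless, since all
-- conditions on a certificate are tested on the values as read.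
def left (d : InvariantCode) (a : ℕ × ℕ) (x : ℕ) : ℕ :=
  d.2.1.1.getD (Nat.pair (Nat.pair a.1 a.2) x) 0
def right (d : InvariantCode) (a : ℕ × ℕ) (x : ℕ) : ℕ :=
  d.2.1.2.getD (Nat.pair (Nat.pair a.1 a.2) x) 0
def states (d : InvariantCode) : List (CompositeStateCode × ℕ) := d.2.2

/-- The class of a word of letters. -/
def classOf (d : InvariantCode) (w : List (ℕ × ℕ)) : ℕ := w.foldr d.left d.one

end InvariantCode

/-- The letters in the successive channels. -/
def contentWord (C : List (List ℕ)) : List (ℕ × ℕ) :=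
  (List.range C.length).flatMap fun e => (C.getD e []).map fun m => (e, m)

namespace InvariantCode

/-- The tables are those of a quotient of the monoid of channel contents. -/
def IsQuotient (c : ProtocolCode) (d : InvariantCode) : Prop :=
  d.one < d.size ∧
  (∀ a ∈ c.letters, d.left a d.one = d.right a d.one ∧ ∀ x < d.size, d.left a x < d.size) ∧
  ∀ a ∈ c.letters, ∀ b ∈ c.letters, ∀ x < d.size,
    d.left a (d.right b x) = d.right b (d.left a x) ∧
    (¬ a.1 = b.1 → d.left a (d.left b x) = d.left b (d.left a x))

/-- The set of states is closed under the steps. -/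
def IsClosed (c : ProtocolCode) (d : InvariantCode) : Prop :=
  ∀ y ∈ d.states, ∀ t ∈ c.transitions, y.1[t.1]? = some t.2.1 →
    (t.2.2.1.1 = true → (y.1.set t.1 t.2.2.2, d.right t.2.2.1.2 y.2) ∈ d.states) ∧
    -- A class can be divisible by a letter in several ways, so every class `x` that the letter
    -- sends to `y.2` counts as a possible remaining content.
    (t.2.2.1.1 = false → ∀ x < d.size, d.left t.2.2.1.2 x = y.2 →
      (y.1.set t.1 t.2.2.2, x) ∈ d.states)

/-- The data form an inductive invariant that excludes the given global states. -/
def Excludes (c : ProtocolCode) (d : InvariantCode) (l : List GlobalStateCode) : Prop :=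
  d.IsQuotient c ∧ d.IsClosed c ∧ (c.initial.1, d.one) ∈ d.states ∧
    ∀ g ∈ l, ¬ (g.1, d.classOf (contentWord g.2)) ∈ d.states

section Primrec

variable {α : Type*} [Primcodable α]

@[fun_prop]
theorem primrec_left {f : α → InvariantCode} {g : α → ℕ × ℕ} {h : α → ℕ}
    (hf : Primrec f) (hg : Primrec g) (hh : Primrec h) :
    Primrec fun a => left (f a) (g a) (h a) := by
  unfold left; fun_prop

@[fun_prop]
theorem primrec_right {f : α → InvariantCode} {g : α → ℕ × ℕ} {h : α → ℕ}
    (hf : Primrec f) (hg : Primrec g) (hh : Primrec h) :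
    Primrec fun a => right (f a) (g a) (h a) := by
  unfold right; fun_prop

@[fun_prop]
theorem primrec_size : Primrec size := by unfold size; fun_prop

@[fun_prop]
theorem primrec_one : Primrec one := by unfold one; fun_prop

@[fun_prop]
theorem primrec_states : Primrec states := by unfold states; fun_prop

@[fun_prop]
theorem primrec_classOf {f : α → InvariantCode} {g : α → List (ℕ × ℕ)}
    (hf : Primrec f) (hg : Primrec g) : Primrec fun a => classOf (f a) (g a) := by
  unfold classOf
  exact primrec_foldr (h := fun a x y => (f a).left x y) hg (by fun_prop) (by fun_prop)

@[fun_prop]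
theorem _root_.CFSM.primrec_contentWord : Primrec contentWord := by
  unfold contentWord; fun_prop

theorem primrecPred_isQuotient :
    PrimrecPred fun q : ProtocolCode × InvariantCode => q.2.IsQuotient q.1 := by
  unfold IsQuotient
  refine PrimrecPred.and (primrecPred_lt ?_ ?_) (PrimrecPred.and ?_ ?_)
  · fun_prop
  · fun_prop
  · apply primrecPred_forall_mem
    · fun_prop
    · apply PrimrecPred.and
      · apply primrecPred_eq <;> fun_prop
      · apply primrecPred_forall_lt
        · fun_prop
        · apply primrecPred_lt <;> fun_prop
  · apply primrecPred_forall_mem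
    · fun_prop
    · apply primrecPred_forall_mem
      · fun_prop
      · apply primrecPred_forall_lt
        · fun_prop
        · apply PrimrecPred.and
          · apply primrecPred_eq <;> fun_prop
          · apply primrecPred_imp
            · apply PrimrecPred.not
              apply primrecPred_eq <;> fun_prop
            · apply primrecPred_eq <;> fun_prop

theorem primrecPred_isClosed :
    PrimrecPred fun q : ProtocolCode × InvariantCode => q.2.IsClosed q.1 := by
  unfold IsClosed
  refine primrecPred_forall_mem (by fun_prop) (primrecPred_forall_mem (by fun_prop)
    (primrecPred_imp (primrecPred_eq (by fun_prop) (by fun_prop)) (PrimrecPred.and ?_ ?_)))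
  · exact primrecPred_imp (primrecPred_eq (by fun_prop) (by fun_prop))
      (primrecPred_mem (by fun_prop) (by fun_prop))
  · exact primrecPred_imp (primrecPred_eq (by fun_prop) (by fun_prop))
      (primrecPred_forall_lt (by fun_prop) (primrecPred_imp
        (primrecPred_eq (by fun_prop) (by fun_prop)) (primrecPred_mem (by fun_prop) (by fun_prop))))

theorem primrecPred_excludes :
    PrimrecPred fun q : (ProtocolCode × List GlobalStateCode) × InvariantCode =>
      q.2.Excludes q.1.1 q.1.2 := by
  unfold Excludes
  have hf : Primrec fun q : (ProtocolCode × List GlobalStateCode) × InvariantCode =>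
      (q.1.1, q.2) := by
    fun_prop
  refine (primrecPred_isQuotient.comp hf).and ((primrecPred_isClosed.comp hf).and
    ((primrecPred_mem (by fun_prop) (by fun_prop)).and ?_))
  exact primrecPred_forall_mem (by fun_prop) (primrecPred_mem (by fun_prop) (by fun_prop)).not

end Primrec

end InvariantCode

/-! ### The parallel search. -/

open Classical in
/-- Search in parallel for a path to one of the given global states and for an inductive invariant
that excludes them. -/
noncomputable def searchStep (i : ProtocolCode × List GlobalStateCode) (n : ℕ) : Option Bool :=
  if ∃ g ∈ i.1.reachedIn n, g ∈ i.2 then some true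
  else (Encodable.decode (α := InvariantCode) n).bind fun d =>
    if d.Excludes i.1 i.2 then some false else none

theorem primrec_searchStep : Primrec₂ searchStep := by
  classical
  unfold searchStep
  refine Primrec.ite (primrecPred_exists_mem (by fun_prop) (primrecPred_mem (by fun_prop)
    (by fun_prop))) (by fun_prop) (Primrec.option_bind (Primrec.decode.comp Primrec.snd)
    (Primrec.ite ?_ (by fun_prop) (by fun_prop)))
  exact InvariantCode.primrecPred_excludes.comp (f := fun q : ((ProtocolCode × List GlobalStateCode) × ℕ) ×
    InvariantCode => (q.1.1, q.2)) (by fun_prop)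

/-- The algorithm that decides whether one of the given global states is reachable. -/
noncomputable def search (i : ProtocolCode × List GlobalStateCode) : Part Bool :=
  Nat.rfindOpt (searchStep i)

theorem partrec_search : Partrec search :=
  Partrec.rfindOpt primrec_searchStep.to_comp

/-- Post's argument: `Q` and its negation both have witnesses that the search meets at some stage,
and each value it can return comes with such a witness. -/
theorem mem_search {i : ProtocolCode × List GlobalStateCode} {Q : Prop}
    (pos : Q ↔ ∃ n, ∃ g ∈ i.1.reachedIn n, g ∈ i.2)
    (neg : ¬ Q ↔ ∃ d : InvariantCode, d.Excludes i.1 i.2) :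
    ∃ answer ∈ search i, (answer = true ↔ Q) := by
  have dom : (search i).Dom := by
    refine Nat.rfindOpt_dom.2 ?_
    by_cases h : Q
    · obtain ⟨n, hn⟩ := pos.1 h
      exact ⟨n, true, by simp [searchStep, hn]⟩
    · obtain ⟨d, hd⟩ := neg.1 h
      -- A stage number serves both as the length of runs and as the code of a candidate
      -- certificate.
      refine ⟨Encodable.encode d, false, ?_⟩
      have : ¬ ∃ g ∈ i.1.reachedIn (Encodable.encode d), g ∈ i.2 := fun h' => h (pos.2 ⟨_, h'⟩)
      simp only [searchStep, if_neg this, Encodable.encodek, Option.bind_some, if_pos hd,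
        Option.mem_def]
  refine ⟨_, Part.get_mem dom, ?_⟩
  obtain ⟨n, hn⟩ := Nat.rfindOpt_spec (Part.get_mem dom)
  rw [Option.mem_def] at hn
  unfold searchStep at hn
  split_ifs at hn with h
  · simp only [Option.some.injEq] at hn
    simp [← hn, pos.2 ⟨n, h⟩]
  · obtain ⟨d, -, hd⟩ := Option.bind_eq_some_iff.1 hn
    split_ifs at hd with h'
    simp only [Option.some.injEq] at hd
    simp [← hd, neg.2 ⟨d, h'⟩]

end CFSM

namespace CFSM

/-! ### Families listed in the order of a numbering. -/

section IndexedList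

variable {ι α : Type*} {n : ℕ} (e : ι ≃ Fin n)

/-- The family `f` as a list, in the order of the numbering `e`. -/
def listOf (f : ι → α) : List α := List.ofFn fun i => f (e.symm i)

@[simp]
theorem length_listOf (f : ι → α) : (listOf e f).length = n := by simp [listOf]

@[simp]
theorem listOf_getElem? (f : ι → α) (j : ι) : (listOf e f)[(e j : ℕ)]? = some (f j) := by
  simp [listOf]

@[simp]
theorem listOf_getElem (f : ι → α) (j : ι) (h : (e j : ℕ) < (listOf e f).length) :
    (listOf e f)[(e j : ℕ)] = f j := by
  simp [listOf]

@[simp]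
theorem listOf_getD (f : ι → α) (j : ι) (d : α) : (listOf e f).getD (e j) d = f j := by
  simp [List.getD_eq_getElem?_getD]

theorem listOf_map {β : Type*} (f : ι → α) (g : α → β) :
    (listOf e f).map g = listOf e fun j => g (f j) := by
  simp [listOf, List.map_ofFn, Function.comp_def]

theorem listOf_set {f f' : ι → α} (j : ι) (h : ∀ i, i ≠ j → f i = f' i) :
    (listOf e f).set (e j) (f' j) = listOf e f' := by
  refine List.ext_getElem (by simp) fun i hi hi' => ?_
  obtain ⟨i, rfl⟩ : ∃ k, (e k : ℕ) = i := ⟨e.symm ⟨i, by simpa using hi'⟩, by simp⟩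
  rw [List.getElem_set]
  split_ifs with hij
  · obtain rfl : j = i := e.injective (Fin.ext hij)
    simp [listOf]
  · simpa [listOf] using h i fun hh => hij (by rw [hh])

theorem listOf_injective : Function.Injective (listOf e : (ι → α) → List α) := by
  intro f g h
  funext j
  simpa using (congrArg (fun l => l[(e j : ℕ)]?) h)

/-- `transitions`, `letters` and `contentWord` all have this shape. The default `d` is never read,
as the indices stay in range. -/
theorem mem_flatMap_range_listOf {β : Type*} (f : ι → α) (d : α) (g : ℕ → α → List β) (x : β) :
    x ∈ (List.range (listOf e f).length).flatMap (fun i => g i ((listOf e f).getD i d)) ↔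
      ∃ j, x ∈ g (e j) (f j) := by
  simp only [List.mem_flatMap, List.mem_range, length_listOf]
  constructor
  · rintro ⟨i, hi, hx⟩
    obtain ⟨i, rfl⟩ : ∃ k, (e k : ℕ) = i := ⟨e.symm ⟨i, hi⟩, by simp⟩
    exact ⟨i, by simpa using hx⟩
  · rintro ⟨j, hx⟩
    exact ⟨e j, (e j).2, by simpa using hx⟩

theorem forall₂_listOf {β : Type*} {R : α → β → Prop} {l : List α} {f : ι → β} :
    List.Forall₂ R l (listOf e f) ↔ ∃ g : ι → α, l = listOf e g ∧ ∀ j, R (g j) (f j) := by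
  rw [List.forall₂_iff_get]
  constructor
  · rintro ⟨hl, h⟩
    have hn : l.length = n := by simpa using hl
    refine ⟨fun j => l.get ⟨e j, by rw [hn]; exact (e j).2⟩,
      List.ext_getElem (by simp [hn]) fun i hi hi' => by simp [listOf], fun j => ?_⟩
    simpa [listOf] using h (e j) (by rw [hn]; exact (e j).2) (by simp)
  · rintro ⟨g, rfl, h⟩
    exact ⟨by simp, fun i hi hi' => by simpa [listOf] using h _⟩

end IndexedList

/-- `A` and `B` collect the letters of the channels before and after `e`; they do not depend on `u`.
Hence a letter put at the front of channel `e` only has to pass `A`, and one put at its end only has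
to pass `B`. -/
theorem exists_contentWord_set (C : List (List ℕ)) {e : ℕ} (he : e < C.length) :
    ∃ A B : List (ℕ × ℕ), (∀ a ∈ A, a.1 ≠ e) ∧ (∀ a ∈ B, a.1 ≠ e) ∧
      ∀ u : List ℕ, contentWord (C.set e u) = A ++ (u.map fun m => (e, m)) ++ B := by
  obtain ⟨m, hm⟩ := Nat.exists_eq_add_of_lt he
  refine ⟨(List.range e).flatMap fun i => (C.getD i []).map fun m => (i, m),
    (List.range m).flatMap fun i => (C.getD (e + 1 + i) []).map fun m => (e + 1 + i, m),
    ?_, ?_, fun u => ?_⟩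
  · simp only [List.mem_flatMap, List.mem_range, List.mem_map]
    rintro a ⟨i, hi, x, -, rfl⟩
    exact hi.ne
  · simp only [List.mem_flatMap, List.mem_range, List.mem_map]
    rintro a ⟨i, hi, x, -, rfl⟩
    simp only
    omega
  · have hr : List.range (C.set e u).length =
        List.range e ++ [e] ++ (List.range m).map (e + 1 + ·) := by
      rw [List.length_set, hm, show e + m + 1 = e + 1 + m by omega, List.range_add,
        List.range_succ]
    unfold contentWord
    rw [hr, List.flatMap_append, List.flatMap_append, List.flatMap_map]
    congr 1
    · congr 1
      · refine List.flatMap_congr fun i hi => ?_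
        have : e ≠ i := (List.mem_range.1 hi).ne'
        simp [List.getD_eq_getElem?_getD, List.getElem?_set_ne this]
      · simp [List.getD_eq_getElem?_getD, he]
    · refine List.flatMap_congr fun i hi => ?_
      have : e ≠ e + 1 + i := by omega
      simp [List.getD_eq_getElem?_getD, List.getElem?_set_ne this]

/-! ### Classes of words in a quotient given by tables. -/

namespace InvariantCode

variable {c : ProtocolCode} {d : InvariantCode}

theorem IsQuotient.classOf_lt (h : d.IsQuotient c) {w : List (ℕ × ℕ)} (hw : ∀ a ∈ w, a ∈ c.letters) :
    d.classOf w < d.size := by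
  induction w with
  | nil => exact h.1
  | cons a w ih =>
    simp only [List.mem_cons, forall_eq_or_imp] at hw
    exact (h.2.1 a hw.1).2 _ (ih hw.2)

/-- The letter `a` moves to the front across letters of other channels, with which its left action
commutes. -/
theorem IsQuotient.classOf_append_cons_left (h : d.IsQuotient c) {a : ℕ × ℕ} {u v : List (ℕ × ℕ)}
    (ha : a ∈ c.letters) (hu : ∀ b ∈ u, b ∈ c.letters) (hv : ∀ b ∈ v, b ∈ c.letters)
    (hne : ∀ b ∈ u, b.1 ≠ a.1) :
    d.classOf (u ++ a :: v) = d.left a (d.classOf (u ++ v)) := by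
  induction u with
  | nil => rfl
  | cons b u ih =>
    simp only [List.mem_cons, forall_eq_or_imp] at hu hne
    have hlt : d.classOf (u ++ v) < d.size := h.classOf_lt fun b hb =>
      (List.mem_append.1 hb).elim (hu.2 b) (hv b)
    calc d.left b (d.classOf (u ++ a :: v)) = d.left b (d.left a (d.classOf (u ++ v))) := by
          rw [ih hu.2 hne.2]
      _ = d.left a (d.left b (d.classOf (u ++ v))) := (h.2.2 b hu.1 a ha _ hlt).2 hne.1

/-- The right action of `a` commutes with all left actions, so `u` may be arbitrary. Across `v` the
left action of `a` travels inwards to the unit, where it agrees with the right action. -/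
theorem IsQuotient.classOf_append_cons_right (h : d.IsQuotient c) {a : ℕ × ℕ} {u v : List (ℕ × ℕ)}
    (ha : a ∈ c.letters) (hu : ∀ b ∈ u, b ∈ c.letters) (hv : ∀ b ∈ v, b ∈ c.letters)
    (hne : ∀ b ∈ v, b.1 ≠ a.1) :
    d.classOf (u ++ a :: v) = d.right a (d.classOf (u ++ v)) := by
  induction u with
  | nil =>
    rw [List.nil_append, List.nil_append]
    induction v with
    | nil => exact (h.2.1 a ha).1
    | cons b v ih =>
      simp only [List.mem_cons, forall_eq_or_imp] at hv hne
      have hlt := h.classOf_lt hv.2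
      calc d.left a (d.left b (d.classOf v)) = d.left b (d.left a (d.classOf v)) :=
            (h.2.2 a ha b hv.1 _ hlt).2 (Ne.symm hne.1)
        _ = d.left b (d.right a (d.classOf v)) := congrArg _ (ih hv.2 hne.2)
        _ = d.right a (d.left b (d.classOf v)) := (h.2.2 b hv.1 a ha _ hlt).1
  | cons b u ih =>
    simp only [List.mem_cons, forall_eq_or_imp] at hu
    have hlt : d.classOf (u ++ v) < d.size := h.classOf_lt fun b hb =>
      (List.mem_append.1 hb).elim (hu.2 b) (hv b)
    calc d.left b (d.classOf (u ++ a :: v)) = d.left b (d.right a (d.classOf (u ++ v))) := by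
          rw [ih hu.2]
      _ = d.right a (d.left b (d.classOf (u ++ v))) := (h.2.2 b hu.1 a ha _ hlt).1

end InvariantCode

/-! ### Channel contents under multiplication by single messages. -/

namespace Protocol

variable {P : Protocol.{u}}

open Classical in
/-- Add a message at the front of a channel. -/
noncomputable def pushFront (ξ : P.E) (b : P.M ξ) (C : P.ChannelContent) : P.ChannelContent :=
  Function.update C ξ (b :: C ξ)

open Classical in
/-- Add a message at the end of a channel. -/
noncomputable def pushBack (ξ : P.E) (b : P.M ξ) (C : P.ChannelContent) : P.ChannelContent :=
  Function.update C ξ (C ξ ++ [b])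

theorem pushFront_eq {ξ : P.E} {b : P.M ξ} {C C' : P.ChannelContent}
    (h : ∀ ζ, ζ ≠ ξ → C ζ = C' ζ) (hξ : C ξ = b :: C' ξ) : C = pushFront ξ b C' := by
  funext ζ
  by_cases hζ : ζ = ξ
  · subst hζ; simp [pushFront, hξ]
  · simp [pushFront, hζ, h]

theorem pushBack_eq {ξ : P.E} {b : P.M ξ} {C C' : P.ChannelContent}
    (h : ∀ ζ, ζ ≠ ξ → C ζ = C' ζ) (hξ : C' ξ = C ξ ++ [b]) : C' = pushBack ξ b C := by
  funext ζ
  by_cases hζ : ζ = ξ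
  · subst hζ; simp [pushBack, hξ]
  · simp [pushBack, hζ, h]

/-- Left and right multiplications commute, even within one channel. This and the next two lemmas
supply the identities that `IsQuotient` demands. -/
theorem pushFront_pushBack (ξ ζ : P.E) (b : P.M ξ) (m : P.M ζ) (C : P.ChannelContent) :
    pushFront ξ b (pushBack ζ m C) = pushBack ζ m (pushFront ξ b C) := by
  funext η
  unfold pushFront pushBack
  by_cases h : ξ = ζ
  · subst h
    by_cases hη : η = ξ
    · subst hη; simp
    · simp [hη]
  · by_cases hη : η = ξ
    · subst hη; simp [h]
    · by_cases hη' : η = ζ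
      · subst hη'; simp [hη]
      · simp [hη, hη']

theorem pushFront_comm {ξ ζ : P.E} (h : ξ ≠ ζ) (b : P.M ξ) (m : P.M ζ) (C : P.ChannelContent) :
    pushFront ξ b (pushFront ζ m C) = pushFront ζ m (pushFront ξ b C) := by
  funext η
  unfold pushFront
  by_cases hη : η = ξ
  · subst hη; simp [h]
  · by_cases hη' : η = ζ
    · subst hη'; simp [hη]
    · simp [hη, hη']

theorem pushFront_empty (ξ : P.E) (b : P.M ξ) :
    pushFront ξ b P.emptyContent = pushBack ξ b P.emptyContent := by
  simp [pushFront, pushBack, emptyContent]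

/-- Induction on the total length of the channels: a content that is not empty has a message to
strip from the front of some channel. -/
theorem content_induction {p : P.ChannelContent → Prop} (empty : p P.emptyContent)
    (push : ∀ ξ b C, p C → p (pushFront ξ b C)) (C : P.ChannelContent) : p C := by
  classical
  have := P.finite_E
  have := Fintype.ofFinite P.E
  induction h : ∑ ξ, (C ξ).length generalizing C with
  | zero =>
    have : C = P.emptyContent := by
      funext ξ
      simpa [emptyContent] using (Finset.sum_eq_zero_iff.1 h) ξ (Finset.mem_univ ξ)
    rwa [this]
  | succ n ih =>
    obtain ⟨ξ, -, hξ⟩ : ∃ ξ ∈ Finset.univ, (C ξ).length ≠ 0 := by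
      by_contra! h0
      rw [Finset.sum_eq_zero h0] at h
      omega
    obtain ⟨b, l, hl⟩ := List.exists_cons_of_length_pos (Nat.pos_of_ne_zero hξ)
    have hC : C = pushFront ξ b (Function.update C ξ l) :=
      pushFront_eq (fun ζ hζ => by simp [hζ]) (by simp [hl])
    rw [hC]
    refine push _ _ _ (ih _ ?_)
    rw [← Finset.add_sum_erase _ _ (Finset.mem_univ ξ)] at h ⊢
    have : ∑ x ∈ Finset.univ.erase ξ, (Function.update C ξ l x).length =
        ∑ x ∈ Finset.univ.erase ξ, (C x).length :=
      Finset.sum_congr rfl fun x hx => by simp [Finset.ne_of_mem_erase hx]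
    rw [this]
    simp [hl] at h ⊢
    omega

theorem step_send {G : P.GlobalState} {ξ : P.E} {b : P.M ξ} {S' : P.CompositeState}
    (machine : (G.1 (P.tail ξ), Label.send ξ rfl b, S' (P.tail ξ)) ∈ P.T (P.tail ξ))
    (others : ∀ j, j ≠ P.tail ξ → G.1 j = S' j) : P.Step G (S', pushBack ξ b G.2) :=
  .send _ _ _ _ ξ b machine others (fun ζ hζ => by simp [pushBack, hζ]) (by simp [pushBack])

theorem step_recv {S : P.CompositeState} {G : P.GlobalState} {ξ : P.E} {b : P.M ξ}
    (machine : (S (P.head ξ), Label.recv ξ rfl b, G.1 (P.head ξ)) ∈ P.T (P.head ξ))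
    (others : ∀ j, j ≠ P.head ξ → S j = G.1 j) : P.Step (S, pushFront ξ b G.2) G :=
  .recv _ _ _ _ ξ b machine others (fun ζ hζ => by simp [pushFront, hζ]) (by simp [pushFront])

/-! ### Agreement of the protocol with its code, and soundness of certificates. -/

namespace Presentation

variable (ν : P.Presentation)

def codeContent (C : P.ChannelContent) : List (List ℕ) :=
  listOf ν.edge fun ξ => (C ξ).map fun b => (ν.message ξ b : ℕ)

def codeLetter (ξ : P.E) (b : P.M ξ) : ℕ × ℕ := (ν.edge ξ, ν.message ξ b)

theorem codeGlobal_eq (G : P.GlobalState) :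
    ν.codeGlobal G = (ν.codeComposite G.1, ν.codeContent G.2) := rfl

theorem codeComposite_eq (S : P.CompositeState) :
    ν.codeComposite S = listOf ν.node fun j => (ν.state j (S j) : ℕ) := rfl

theorem code_eq : ν.code = (listOf ν.node ν.codeMachine, listOf ν.edge ν.codeEdge) := rfl

theorem codeComposite_injective : Function.Injective ν.codeComposite := by
  intro S S' h
  rw [codeComposite_eq, codeComposite_eq] at h
  funext j
  exact (ν.state j).injective (Fin.ext (congrFun (listOf_injective _ h) j))

theorem codeContent_injective : Function.Injective ν.codeContent := by
  intro C C' h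
  funext ξ
  refine List.map_injective_iff.2 ?_ (congrFun (listOf_injective _ h) ξ)
  exact fun a b hab => (ν.message ξ).injective (Fin.ext hab)

theorem codeGlobal_injective : Function.Injective ν.codeGlobal := by
  intro G G' h
  rw [codeGlobal_eq, codeGlobal_eq, Prod.mk.injEq] at h
  exact Prod.ext (ν.codeComposite_injective h.1) (ν.codeContent_injective h.2)

theorem codeComposite_set {S S' : P.CompositeState} (j : P.N) (h : ∀ i, i ≠ j → S i = S' i) :
    (ν.codeComposite S).set (ν.node j) (ν.state j (S' j)) = ν.codeComposite S' := by
  rw [codeComposite_eq]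
  exact listOf_set ν.node (f' := fun j => (ν.state j (S' j) : ℕ)) j fun i hi => by rw [h i hi]

@[simp]
theorem codeComposite_getElem? (S : P.CompositeState) (j : P.N) :
    (ν.codeComposite S)[(ν.node j : ℕ)]? = some (ν.state j (S j) : ℕ) := by
  simp [codeComposite_eq]

@[simp]
theorem codeContent_getD (C : P.ChannelContent) (ξ : P.E) :
    (ν.codeContent C).getD (ν.edge ξ) [] = (C ξ).map fun b => (ν.message ξ b : ℕ) := by
  rw [codeContent, listOf_getD]

theorem codeContent_set {C C' : P.ChannelContent} (ξ : P.E) (h : ∀ ζ, ζ ≠ ξ → C ζ = C' ζ) :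
    (ν.codeContent C).set (ν.edge ξ) ((C' ξ).map fun b => (ν.message ξ b : ℕ)) =
      ν.codeContent C' :=
  listOf_set ν.edge (f' := fun ξ => (C' ξ).map fun b => (ν.message ξ b : ℕ)) ξ
    fun ζ hζ => by rw [h ζ hζ]

theorem mem_transitions_code {t : TransitionCode} : t ∈ ν.code.transitions ↔
    ∃ j, ∃ s ∈ P.T j, t = (↑(ν.node j), ↑(ν.state j s.1), ν.codeSym s.2.1, ↑(ν.state j s.2.2)) := by
  rw [code_eq]
  refine (mem_flatMap_range_listOf ν.node _ _
    (fun j (F : ℕ × ℕ × List (ℕ × (Bool × ℕ × ℕ) × ℕ)) => F.2.2.map fun t => (j, t)) t).trans ?_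
  simp only [codeMachine, List.map_map, List.mem_map, ν.mem_transitions, Function.comp_apply,
    eq_comm (a := t)]

theorem mem_letters_code {a : ℕ × ℕ} : a ∈ ν.code.letters ↔ ∃ ξ b, a = ν.codeLetter ξ b := by
  rw [code_eq]
  refine (mem_flatMap_range_listOf ν.edge _ _
    (fun e (F : ℕ × ℕ × ℕ) => (List.range F.2.2).map fun m => (e, m)) a).trans ?_
  simp only [codeEdge, List.mem_map, List.mem_range, codeLetter]
  constructor
  · rintro ⟨ξ, m, hm, rfl⟩
    exact ⟨ξ, (ν.message ξ).symm ⟨m, hm⟩, by simp⟩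
  · rintro ⟨ξ, b, rfl⟩
    exact ⟨ξ, _, (ν.message ξ b).2, rfl⟩

theorem initial_code : ν.code.initial = ν.codeGlobal P.init := by
  rw [code_eq, ProtocolCode.initial, listOf_map, listOf_map]
  rfl

/-- The numberings are injective, so comparing numbers of states and of front messages enables
exactly the transitions of the protocol. -/
theorem mem_successors_singleton {G : P.GlobalState} {g : GlobalStateCode} :
    g ∈ ν.code.transitions.flatMap (ProtocolCode.fire (ν.codeGlobal G)) ↔
      ∃ G', P.Step G G' ∧ g = ν.codeGlobal G' := by
  classical
  obtain ⟨S, C⟩ := G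
  rw [List.mem_flatMap]
  constructor
  · rintro ⟨t, ht, hg⟩
    obtain ⟨j, ⟨p, s, q⟩, hs, rfl⟩ := ν.mem_transitions_code.1 ht
    simp only [ProtocolCode.fire, codeGlobal_eq, codeComposite_getElem?, Option.some.injEq,
      Fin.val_inj, EmbeddingLike.apply_eq_iff_eq] at hg
    by_cases hp : S j = p
    swap
    · simp [hp] at hg
    subst hp
    rw [if_pos rfl] at hg
    obtain ⟨ξ, rfl, b⟩ | ⟨ξ, rfl, b⟩ := s
    · simp only [codeSym, codeContent_getD, Bool.false_eq_true, if_false] at hg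
      by_cases hh : ((C ξ).map fun b => (ν.message ξ b : ℕ)).head? = some (ν.message ξ b : ℕ)
      swap
      · rw [if_neg hh] at hg
        simp at hg
      rw [if_pos hh] at hg
      obtain ⟨l, hl⟩ := List.head?_eq_some_iff.1 hh
      obtain ⟨b', l', hC, hb, rfl⟩ := List.map_eq_cons_iff.1 hl
      obtain rfl : b' = b := (ν.message ξ).injective (Fin.ext hb)
      have hC' : C = pushFront ξ b' (Function.update C ξ l') :=
        pushFront_eq (fun ζ hζ => by simp [hζ]) (by simpa using hC)
      refine ⟨(Function.update S (P.head ξ) q, Function.update C ξ l'), ?_, ?_⟩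
      · have := step_recv (S := S) (b := b')
          (G := (Function.update S (P.head ξ) q, Function.update C ξ l'))
          (by simpa using hs) (fun j hj => by simp [hj])
        rwa [← hC'] at this
      · have e1 := ν.codeComposite_set (S := S) (S' := Function.update S (P.head ξ) q) (P.head ξ)
          fun i hi => by simp [hi]
        have e2 := ν.codeContent_set (C := C) (C' := Function.update C ξ l') ξ
          fun i hi => by simp [hi]
        rw [Function.update_self] at e1 e2
        rw [List.mem_singleton.1 hg, codeGlobal_eq, ← e1, ← e2, hl, List.tail_cons]
    · simp only [codeSym, codeContent_getD, if_true, List.mem_singleton] at hg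
      refine ⟨(Function.update S (P.tail ξ) q, pushBack ξ b C), step_send (by simpa using hs)
        (fun j hj => by simp [hj]), ?_⟩
      have e1 := ν.codeComposite_set (S := S) (S' := Function.update S (P.tail ξ) q) (P.tail ξ)
        fun i hi => by simp [hi]
      have e2 := ν.codeContent_set (C := C) (C' := pushBack ξ b C) ξ
        fun i hi => by simp [pushBack, hi]
      rw [Function.update_self] at e1
      rw [pushBack, Function.update_self, List.map_append, List.map_singleton] at e2
      rw [hg, codeGlobal_eq, ← e1, pushBack, ← e2]
  · rintro ⟨G', hstep, rfl⟩
    cases hstep with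
    | recv S S' C C' β b machine others otherChannels channel =>
      refine ⟨_, ν.mem_transitions_code.2 ⟨_, _, machine, rfl⟩, ?_⟩
      simp only [ProtocolCode.fire, codeGlobal_eq, codeComposite_getElem?, codeSym,
        codeContent_getD, channel]
      simp [ν.codeComposite_set _ others, ν.codeContent_set _ otherChannels]
    | send S S' C C' β b machine others otherChannels channel =>
      refine ⟨_, ν.mem_transitions_code.2 ⟨_, _, machine, rfl⟩, ?_⟩
      simp only [ProtocolCode.fire, codeGlobal_eq, codeComposite_getElem?, codeSym,
        codeContent_getD]
      have := ν.codeContent_set _ otherChannels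
      rw [channel, List.map_append] at this
      simpa [ν.codeComposite_set _ others] using this.symm

theorem mem_reachedIn_succ {n : ℕ} {g : GlobalStateCode} : g ∈ ν.code.reachedIn (n + 1) ↔
    ∃ h ∈ ν.code.reachedIn n, g ∈ ν.code.transitions.flatMap (ProtocolCode.fire h) := by
  simp only [ProtocolCode.reachedIn, Function.iterate_succ_apply', ProtocolCode.successors]
  rw [List.mem_flatMap]

theorem exists_mem_reachedIn {g : GlobalStateCode} :
    (∃ n, g ∈ ν.code.reachedIn n) ↔ ∃ G, P.Reachable G ∧ g = ν.codeGlobal G := by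
  constructor
  · rintro ⟨n, hn⟩
    induction n generalizing g with
    | zero =>
      refine ⟨P.init, .refl, ?_⟩
      simpa [ProtocolCode.reachedIn, initial_code] using hn
    | succ n ih =>
      obtain ⟨h, hh, hg⟩ := ν.mem_reachedIn_succ.1 hn
      obtain ⟨G, hG, rfl⟩ := ih hh
      obtain ⟨G', hG', rfl⟩ := ν.mem_successors_singleton.1 hg
      exact ⟨G', hG.tail hG', rfl⟩
  · rintro ⟨G, hG, rfl⟩
    induction hG with
    | refl => exact ⟨0, by simp [ProtocolCode.reachedIn, initial_code]⟩
    | tail _ hstep ih =>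
      obtain ⟨n, hn⟩ := ih
      exact ⟨n + 1, ν.mem_reachedIn_succ.2 ⟨_, hn, ν.mem_successors_singleton.2 ⟨_, hstep, rfl⟩⟩⟩

/-- The class of a channel content. -/
def contentClass (d : InvariantCode) (C : P.ChannelContent) : ℕ :=
  d.classOf (contentWord (ν.codeContent C))

theorem mem_letters_of_mem_contentWord (C : P.ChannelContent) :
    ∀ a ∈ contentWord (ν.codeContent C), a ∈ ν.code.letters := by
  intro a ha
  obtain ⟨ξ, hξ⟩ := (mem_flatMap_range_listOf ν.edge _ _
    (fun e (l : List ℕ) => l.map fun m => (e, m)) a).1 ha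
  rw [List.map_map, List.mem_map] at hξ
  obtain ⟨b, -, rfl⟩ := hξ
  exact ν.mem_letters_code.2 ⟨ξ, b, rfl⟩

theorem contentClass_lt {d : InvariantCode} (h : d.IsQuotient ν.code) (C : P.ChannelContent) :
    ν.contentClass d C < d.size :=
  h.classOf_lt (ν.mem_letters_of_mem_contentWord C)

theorem exists_contentWord_update (C : P.ChannelContent) (ξ : P.E) :
    ∃ A B : List (ℕ × ℕ), (∀ a ∈ A, a.1 ≠ ν.edge ξ) ∧ (∀ a ∈ B, a.1 ≠ ν.edge ξ) ∧
      ∀ C' : P.ChannelContent, (∀ ζ, ζ ≠ ξ → C ζ = C' ζ) →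
        contentWord (ν.codeContent C') = A ++ (C' ξ).map (ν.codeLetter ξ) ++ B := by
  obtain ⟨A, B, hA, hB, h⟩ := exists_contentWord_set (ν.codeContent C) (e := ν.edge ξ)
    (by simp [codeContent])
  refine ⟨A, B, hA, hB, fun C' hC' => ?_⟩
  rw [← ν.codeContent_set ξ hC', h, List.map_map]
  rfl

theorem contentClass_pushFront {d : InvariantCode} (h : d.IsQuotient ν.code) (ξ : P.E) (b : P.M ξ)
    (C : P.ChannelContent) :
    ν.contentClass d (pushFront ξ b C) = d.left (ν.codeLetter ξ b) (ν.contentClass d C) := by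
  obtain ⟨A, B, hA, hB, hw⟩ := ν.exists_contentWord_update C ξ
  have h1 := hw C fun _ _ => rfl
  have h2 := hw (pushFront ξ b C) fun ζ hζ => by simp [pushFront, hζ]
  rw [show pushFront ξ b C ξ = b :: C ξ by simp [pushFront], List.map_cons, List.append_assoc,
    List.cons_append] at h2
  rw [List.append_assoc] at h1
  have hl := ν.mem_letters_of_mem_contentWord C
  rw [h1] at hl
  rw [contentClass, contentClass, h1, h2]
  exact h.classOf_append_cons_left (ν.mem_letters_code.2 ⟨ξ, b, rfl⟩)
    (fun a ha => hl a (List.mem_append_left _ ha)) (fun a ha => hl a (List.mem_append_right _ ha)) hA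

theorem contentClass_pushBack {d : InvariantCode} (h : d.IsQuotient ν.code) (ξ : P.E) (b : P.M ξ)
    (C : P.ChannelContent) :
    ν.contentClass d (pushBack ξ b C) = d.right (ν.codeLetter ξ b) (ν.contentClass d C) := by
  obtain ⟨A, B, hA, hB, hw⟩ := ν.exists_contentWord_update C ξ
  have h1 := hw C fun _ _ => rfl
  have h2 := hw (pushBack ξ b C) fun ζ hζ => by simp [pushBack, hζ]
  rw [show pushBack ξ b C ξ = C ξ ++ [b] by simp [pushBack], List.map_append, List.map_singleton,
    ← List.append_assoc, List.append_assoc _ [_], List.singleton_append] at h2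
  have hl := ν.mem_letters_of_mem_contentWord C
  rw [h1] at hl
  rw [contentClass, contentClass, h1, h2]
  exact h.classOf_append_cons_right (ν.mem_letters_code.2 ⟨ξ, b, rfl⟩)
    (fun a ha => hl a (List.mem_append_left _ ha)) (fun a ha => hl a (List.mem_append_right _ ha)) hB

theorem contentClass_empty (d : InvariantCode) : ν.contentClass d P.emptyContent = d.one := by
  have : contentWord (ν.codeContent P.emptyContent) = [] := by
    refine List.eq_nil_iff_forall_not_mem.2 fun a ha => ?_
    obtain ⟨ξ, hξ⟩ := (mem_flatMap_range_listOf ν.edge _ _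
      (fun e (l : List ℕ) => l.map fun m => (e, m)) a).1 ha
    simp [emptyContent] at hξ
  rw [contentClass, this]
  rfl

/-- Soundness of certificates, by induction on the run. A send multiplies the class on the right; in
a receive, the class before the step is the left product of the letter with the class after it. -/
theorem mem_states_of_reachable {d : InvariantCode} {l : List GlobalStateCode}
    (h : d.Excludes ν.code l) {G : P.GlobalState} (hG : P.Reachable G) :
    (ν.codeComposite G.1, ν.contentClass d G.2) ∈ d.states := by
  obtain ⟨hq, hc, hi, -⟩ := h
  induction hG with
  | refl =>
    rw [initial_code] at hi
    rw [init, contentClass_empty]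
    exact hi
  | tail _ hstep ih =>
    cases hstep with
    | recv S S' C C' β b machine others otherChannels channel =>
      have := (hc _ ih _ (ν.mem_transitions_code.2 ⟨_, _, machine, rfl⟩) (by simp)).2 rfl
        (ν.contentClass d C') (ν.contentClass_lt hq C')
        (by rw [pushFront_eq otherChannels channel]; exact (ν.contentClass_pushFront hq _ _ _).symm)
      simpa [ν.codeComposite_set _ others] using this
    | send S S' C C' β b machine others otherChannels channel =>
      have := (hc _ ih _ (ν.mem_transitions_code.2 ⟨_, _, machine, rfl⟩) (by simp)).1 rfl
      rw [pushBack_eq otherChannels channel, ν.contentClass_pushBack hq]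
      simp only [ν.codeComposite_set _ others] at this
      exact this

end Presentation

end Protocol

end CFSM

/-! ### Existence of certificates under the recognizable channel property. -/

namespace CFSM

theorem exists_table {I : Type*} [Finite I] {key : I → ℕ} (hkey : Function.Injective key)
    (val : I → ℕ) : ∃ l : List ℕ, ∀ i, l.getD (key i) 0 = val i := by
  obtain ⟨N, hN⟩ := (Set.finite_range key).bddAbove
  refine ⟨(List.range (N + 1)).map (Function.extend key val 0), fun i => ?_⟩
  have : key i < N + 1 := Nat.lt_succ_of_le (hN ⟨i, rfl⟩)
  simp [List.getD_eq_getElem?_getD, this, hkey.extend_apply]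

namespace Protocol

variable {P : Protocol.{u}}

/-- Under the recognizable channel property, the reachability sets are saturated by one congruence
of finite index on the monoid of channel contents. -/
theorem RecognizableChannelProperty.exists_quotient (h : P.RecognizableChannelProperty) :
    ∃ (k : ℕ) (γ : P.ChannelContent → Fin k), Function.Surjective γ ∧
      (∀ C C', γ C = γ C' → (∀ ξ b, γ (pushFront ξ b C) = γ (pushFront ξ b C')) ∧
        (∀ ξ b, γ (pushBack ξ b C) = γ (pushBack ξ b C')) ∧
        ∀ S, P.Reachable (S, C) → P.Reachable (S, C')) := by
  classical
  have := P.finite_N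
  have := P.finite_K
  choose F monoid finite φ A hA using h
  let word (C : P.ChannelContent) : ∀ ξ, FreeMonoid (P.M ξ) := fun ξ => FreeMonoid.ofList (C ξ)
  -- The product over the finitely many composite states recognizes all the relations at once.
  -- Numbering only its range, not the whole product, gives every class a representative.
  let Φ (C : P.ChannelContent) : ∀ S, F S := fun S => φ S (word C)
  obtain ⟨k, ⟨e⟩⟩ := Finite.exists_equiv_fin (Set.range Φ)
  have front (ξ : P.E) (b : P.M ξ) (C : P.ChannelContent) :
      word (pushFront ξ b C) = Pi.mulSingle ξ (FreeMonoid.of b) * word C := by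
    funext ζ
    by_cases hζ : ζ = ξ
    · subst hζ; simp [word, pushFront]
    · simp [word, pushFront, hζ]
  have back (ξ : P.E) (b : P.M ξ) (C : P.ChannelContent) :
      word (pushBack ξ b C) = word C * Pi.mulSingle ξ (FreeMonoid.of b) := by
    funext ζ
    by_cases hζ : ζ = ξ
    · subst hζ; simp [word, pushBack]
    · simp [word, pushBack, hζ]
  refine ⟨k, fun C => e ⟨Φ C, C, rfl⟩, fun x => ?_, fun C C' hC => ?_⟩
  · obtain ⟨⟨-, C, rfl⟩, rfl⟩ := e.surjective x
    exact ⟨C, rfl⟩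
  · have hΦ : Φ C = Φ C' := congrArg Subtype.val (e.injective hC)
    have hS (S : P.CompositeState) : φ S (word C) = φ S (word C') := congrFun hΦ S
    refine ⟨fun ξ b => congrArg e (Subtype.ext (funext fun S => ?_)),
      fun ξ b => congrArg e (Subtype.ext (funext fun S => ?_)), fun S hr => ?_⟩
    · simp only [Φ, front, map_mul, hS]
    · simp only [Φ, back, map_mul, hS]
    · refine (hA S C').2 ?_
      have := (hA S C).1 hr
      change φ S (word C) ∈ A S at this
      rwa [hS] at this

namespace Presentation

variable (ν : P.Presentation)

theorem codeLetter_injective :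
    Function.Injective fun a : (ξ : P.E) × P.M ξ => ν.codeLetter a.1 a.2 := by
  rintro ⟨ξ, b⟩ ⟨ζ, m⟩ h
  simp only [codeLetter, Prod.mk.injEq, Fin.val_inj, EmbeddingLike.apply_eq_iff_eq] at h
  obtain ⟨rfl, h⟩ := h
  obtain rfl := (ν.message ξ).injective (Fin.ext h)
  rfl

theorem exists_letterTable {k : ℕ} (val : ∀ ξ, P.M ξ → Fin k → ℕ) :
    ∃ l : List ℕ, ∀ ξ b (x : Fin k),
      l.getD (Nat.pair (Nat.pair (ν.codeLetter ξ b).1 (ν.codeLetter ξ b).2) x) 0 = val ξ b x := by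
  have := P.finite_E
  have := P.finite_M
  obtain ⟨l, hl⟩ := exists_table (I := ((ξ : P.E) × P.M ξ) × Fin k)
    (key := fun i => Nat.pair (Nat.pair (ν.codeLetter i.1.1 i.1.2).1 (ν.codeLetter i.1.1 i.1.2).2) i.2)
    (fun i j hij => by
      simp only [Nat.pair_eq_pair, Fin.val_inj] at hij
      exact Prod.ext (ν.codeLetter_injective (Prod.ext hij.1.1 hij.1.2)) hij.2)
    fun i => val i.1.1 i.1.2 i.2
  exact ⟨l, fun ξ b x => hl (⟨ξ, b⟩, x)⟩

/-- Completeness: the certificate is the image of the reachability set under the quotient map, which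
loses nothing because the reachability relations are unions of classes. -/
theorem exists_excludes (h : P.RecognizableChannelProperty) {l : List GlobalStateCode}
    (hl : ∀ g ∈ l, ∃ G, ¬ P.Reachable G ∧ g = ν.codeGlobal G) :
    ∃ d : InvariantCode, d.Excludes ν.code l := by
  classical
  have := P.finite_N
  have := P.finite_K
  obtain ⟨k, γ, hγ, hcong⟩ := h.exists_quotient
  choose rep hrep using hγ
  obtain ⟨tl, htl⟩ := ν.exists_letterTable fun ξ b x => (γ (pushFront ξ b (rep x)) : ℕ)
  obtain ⟨tr, htr⟩ := ν.exists_letterTable fun ξ b x => (γ (pushBack ξ b (rep x)) : ℕ)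
  have hfin : Set.Finite {y : CompositeStateCode × ℕ | ∃ S C, P.Reachable (S, C) ∧
      y = (ν.codeComposite S, (γ C : ℕ))} := by
    refine (Set.finite_range fun q : P.CompositeState × Fin k =>
      (ν.codeComposite q.1, (q.2 : ℕ))).subset ?_
    rintro _ ⟨S, C, -, rfl⟩
    exact ⟨(S, γ C), rfl⟩
  let d : InvariantCode := ((k, γ P.emptyContent), (tl, tr), hfin.toFinset.toList)
  have mem {y : CompositeStateCode × ℕ} : y ∈ d.states ↔ ∃ S C, P.Reachable (S, C) ∧
      y = (ν.codeComposite S, (γ C : ℕ)) := by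
    simp [InvariantCode.states, d]
  -- The tables are filled in from representatives; the congruence property makes them right for
  -- every content.
  have left (ξ : P.E) (b : P.M ξ) (C : P.ChannelContent) :
      d.left (ν.codeLetter ξ b) (γ C) = γ (pushFront ξ b C) := by
    rw [← (hcong _ _ (hrep (γ C))).1]
    exact htl ξ b (γ C)
  have right (ξ : P.E) (b : P.M ξ) (C : P.ChannelContent) :
      d.right (ν.codeLetter ξ b) (γ C) = γ (pushBack ξ b C) := by
    rw [← (hcong _ _ (hrep (γ C))).2.1]
    exact htr ξ b (γ C)
  have class_of_lt {x : ℕ} (hx : x < d.size) : ∃ C, x = γ C :=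
    ⟨rep ⟨x, hx⟩, by rw [hrep]⟩
  have quotient : d.IsQuotient ν.code := by
    refine ⟨(γ P.emptyContent).2, fun a ha => ?_, fun a ha b hb x hx => ?_⟩
    · obtain ⟨ξ, b, rfl⟩ := ν.mem_letters_code.1 ha
      refine ⟨?_, fun x hx => ?_⟩
      · change d.left _ (γ P.emptyContent) = d.right _ (γ P.emptyContent)
        rw [left, right, pushFront_empty]
      · obtain ⟨C, rfl⟩ := class_of_lt hx
        rw [left]
        exact (γ _).2
    · obtain ⟨ξ, b, rfl⟩ := ν.mem_letters_code.1 ha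
      obtain ⟨ζ, m, rfl⟩ := ν.mem_letters_code.1 hb
      obtain ⟨C, rfl⟩ := class_of_lt hx
      refine ⟨by rw [left, right, left, right, pushFront_pushBack], fun hne => ?_⟩
      have : ξ ≠ ζ := by
        rintro rfl
        exact hne rfl
      rw [left, left, left, left, pushFront_comm this]
  have classEq (C : P.ChannelContent) : ν.contentClass d C = γ C := by
    induction C using content_induction with
    | empty => exact ν.contentClass_empty d
    | push ξ b C ih => rw [ν.contentClass_pushFront quotient, ih, left]
  refine ⟨d, quotient, ?_, ?_, fun g hg hmem => ?_⟩
  · intro y hy t ht hen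
    obtain ⟨S, C, hr, rfl⟩ := mem.1 hy
    obtain ⟨j, ⟨p, s, q⟩, hs, rfl⟩ := ν.mem_transitions_code.1 ht
    simp only [codeComposite_getElem?, Option.some.injEq, Fin.val_inj,
      EmbeddingLike.apply_eq_iff_eq] at hen
    subst hen
    have hset := ν.codeComposite_set (S := S) (S' := Function.update S j q) j
      fun i hi => by simp [hi]
    rw [Function.update_self] at hset
    obtain ⟨ξ, rfl, b⟩ | ⟨ξ, rfl, b⟩ := s
    · refine ⟨fun hf => by simp [codeSym] at hf, fun _ x hx hleft => ?_⟩
      obtain ⟨C', rfl⟩ := class_of_lt hx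
      -- `C` itself need not begin with `b` on this channel. Saturation replaces it by the content
      -- `pushFront ξ b C'` of the same class, from which the message can be received.
      have hC : γ (pushFront ξ b C') = γ C := Fin.ext ((left ξ b C').symm.trans hleft)
      have hr' := (hcong _ _ hC.symm).2.2 S hr
      refine mem.2 ⟨Function.update S (P.head ξ) q, C', hr'.tail ?_, by rw [← hset]⟩
      exact step_recv (G := (Function.update S (P.head ξ) q, C')) (by simpa using hs)
        fun j hj => by simp [hj]
    · refine ⟨fun _ => ?_, fun hf => by simp [codeSym] at hf⟩
      refine mem.2 ⟨Function.update S (P.tail ξ) q, pushBack ξ b C,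
        hr.tail (step_send (by simpa using hs) fun j hj => by simp [hj]), ?_⟩
      rw [← hset, ← right]
      rfl
  · exact mem.2 ⟨P.home, P.emptyContent, .refl, by rw [initial_code]; rfl⟩
  · obtain ⟨⟨S, C⟩, hG, rfl⟩ := hl g hg
    obtain ⟨S', C', hr, heq⟩ := mem.1 hmem
    change (ν.codeComposite S, ν.contentClass d C) = _ at heq
    rw [classEq, Prod.mk.injEq] at heq
    obtain rfl := ν.codeComposite_injective heq.1
    -- Saturation again: sharing a class with a reachable content at the same composite state
    -- implies being reachable.
    exact hG ((hcong _ _ (Fin.ext heq.2.symm)).2.2 _ hr)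

/-- The entries must be codes of global states: a malformed entry, for instance one with surplus
empty channels, could share its pair with a reachable state and so defeat every certificate. -/
theorem mem_search (h : P.RecognizableChannelProperty) {l : List GlobalStateCode}
    (hl : ∀ g ∈ l, ∃ G, g = ν.codeGlobal G) :
    ∃ answer ∈ search (ν.code, l),
      (answer = true ↔ ∃ G, P.Reachable G ∧ ν.codeGlobal G ∈ l) := by
  refine CFSM.mem_search ?_ ⟨fun hn => ν.exists_excludes h fun g hg => ?_, ?_⟩
  · constructor
    · rintro ⟨G, hG, hGl⟩
      obtain ⟨n, hn⟩ := ν.exists_mem_reachedIn.2 ⟨G, hG, rfl⟩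
      exact ⟨n, _, hn, hGl⟩
    · rintro ⟨n, g, hg, hgl⟩
      obtain ⟨G, hG, rfl⟩ := ν.exists_mem_reachedIn.1 ⟨n, hg⟩
      exact ⟨G, hG, hgl⟩
  · obtain ⟨G, rfl⟩ := hl g hg
    exact ⟨G, fun hG => hn ⟨G, hG, hg⟩, rfl⟩
  · rintro ⟨d, hd⟩ ⟨G, hG, hGl⟩
    exact hd.2.2.2 _ hGl (ν.mem_states_of_reachable hd hG)

theorem codeContent_emptyContent :
    ν.codeContent P.emptyContent = ν.code.2.map fun _ => [] := by
  rw [code_eq, listOf_map]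
  rfl

theorem receive_codeMachine_iff {j : P.N} (p : P.K j) :
    (∀ t ∈ (ν.codeMachine j).2.2, t.1 = ν.state j p → t.2.1.1 = false) ↔ P.IsReceiveState p := by
  simp only [codeMachine, List.mem_map, ν.mem_transitions, forall_exists_index, and_imp]
  constructor
  · intro h ξ hξ b q hT
    simpa [codeSym] using h _ _ hT rfl rfl
  · rintro h _ ⟨p', s, q⟩ hT rfl hp
    simp only [Fin.val_inj, EmbeddingLike.apply_eq_iff_eq] at hp
    subst hp
    obtain ⟨ξ, hξ, b⟩ | ⟨ξ, hξ, b⟩ := s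
    · rfl
    · exact absurd hT (h ξ hξ b q)

end Presentation

end Protocol

theorem ProtocolCode.mem_receiveComposites {c : ProtocolCode} {s : CompositeStateCode} :
    s ∈ c.receiveComposites ↔
      List.Forall₂ (fun p F => p < F.1 ∧ ∀ t ∈ F.2.2, t.1 = p → t.2.1.1 = false) s c.1 := by
  unfold receiveComposites
  induction c.1 generalizing s with
  | nil => simp
  | cons F l ih =>
    rw [List.foldr_cons, List.mem_flatMap]
    simp only [ih, List.mem_flatMap, List.mem_range, List.mem_ite_nil_right, List.mem_singleton,
      List.forall₂_cons_right_iff]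
    constructor
    · rintro ⟨s', hs', p, hp, hr, rfl⟩
      exact ⟨p, s', ⟨hp, hr⟩, hs', rfl⟩
    · rintro ⟨p, s', ⟨hp, hr⟩, hs', rfl⟩
      exact ⟨s', hs', p, hp, hr, rfl⟩

/-! ### The finite list of deadlocked states. -/

namespace Protocol.Presentation

variable {P : Protocol.{u}} (ν : P.Presentation)

theorem mem_deadlocks_code {g : GlobalStateCode} :
    g ∈ ν.code.deadlocks ↔ ∃ G, P.Deadlocked G ∧ g = ν.codeGlobal G := by
  simp only [ProtocolCode.deadlocks, List.mem_map, ProtocolCode.mem_receiveComposites,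
    ← codeContent_emptyContent]
  rw [code_eq]
  simp only [forall₂_listOf]
  constructor
  · rintro ⟨_, ⟨f, rfl, hf⟩, rfl⟩
    choose S hS using fun j => (⟨(ν.state j).symm ⟨f j, (hf j).1⟩, by simp⟩ :
      ∃ p : P.K j, (ν.state j p : ℕ) = f j)
    obtain rfl : (fun j => (ν.state j (S j) : ℕ)) = f := funext hS
    exact ⟨(S, P.emptyContent), ⟨fun j => (ν.receive_codeMachine_iff _).1 (hf j).2, rfl⟩, rfl⟩
  · rintro ⟨⟨S, C⟩, ⟨hS, rfl⟩, rfl⟩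
    exact ⟨_, ⟨_, rfl, fun j => ⟨(ν.state j (S j)).2, (ν.receive_codeMachine_iff _).2 (hS j)⟩⟩, rfl⟩

end Protocol.Presentation

end CFSM

theorem corollary9p6 :
    (∃ f : CFSM.ProtocolCode × CFSM.GlobalStateCode →. Bool, Partrec f ∧
      ∀ (P : CFSM.Protocol.{u}) (ν : P.Presentation), P.RecognizableChannelProperty →
        ∀ G : P.GlobalState,
          ∃ answer ∈ f (ν.code, ν.codeGlobal G), (answer = true ↔ P.Reachable G)) ∧
    (∃ f : CFSM.ProtocolCode × CFSM.CompositeStateCode →. Bool, Partrec f ∧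
      ∀ (P : CFSM.Protocol.{u}) (ν : P.Presentation), P.RecognizableChannelProperty →
        ∀ S : P.CompositeState,
          ∃ answer ∈ f (ν.code, ν.codeComposite S), (answer = true ↔ P.Stable S)) ∧
    (∃ f : CFSM.ProtocolCode →. Bool, Partrec f ∧
      ∀ (P : CFSM.Protocol.{u}) (ν : P.Presentation), P.RecognizableChannelProperty →
        ∃ answer ∈ f ν.code, (answer = true ↔ P.DeadlockFree)) := by
  have single {P : CFSM.Protocol.{u}} (ν : P.Presentation) (h : P.RecognizableChannelProperty)
      (G : P.GlobalState) :
      ∃ answer ∈ CFSM.search (ν.code, [ν.codeGlobal G]), (answer = true ↔ P.Reachable G) := by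
    obtain ⟨answer, hmem, ha⟩ := ν.mem_search h (l := [ν.codeGlobal G])
      fun g hg => ⟨G, List.mem_singleton.1 hg⟩
    refine ⟨answer, hmem, ha.trans ?_⟩
    simp [ν.codeGlobal_injective.eq_iff]
  -- The lists searched for are the given state, the given composite state with empty channels, and
  -- all deadlocked states; the last answer is negated.
  refine ⟨⟨fun i => CFSM.search (i.1, [i.2]), ?_, fun P ν h G => single ν h G⟩,
    ⟨fun i => CFSM.search (i.1, [(i.2, i.1.2.map fun _ => [])]), ?_, fun P ν h S => ?_⟩,
    ⟨fun c => (CFSM.search (c, c.deadlocks)).map not, ?_, fun P ν h => ?_⟩⟩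
  · exact CFSM.partrec_search.comp (g := fun i : CFSM.ProtocolCode × CFSM.GlobalStateCode =>
      (i.1, [i.2])) (Primrec.to_comp (by fun_prop))
  · exact CFSM.partrec_search.comp (g := fun i : CFSM.ProtocolCode × CFSM.CompositeStateCode =>
      (i.1, [(i.2, i.1.2.map fun _ => [])])) (Primrec.to_comp (by fun_prop))
  · beta_reduce
    rw [← ν.codeContent_emptyContent]
    exact single ν h (S, P.emptyContent)
  · refine Partrec.map (CFSM.partrec_search.comp (g := fun c : CFSM.ProtocolCode =>
      (c, c.deadlocks)) ?_) (Primrec.not.comp Primrec.snd).to_comp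
    exact (Primrec.id.pair CFSM.ProtocolCode.primrec_deadlocks).to_comp
  · obtain ⟨answer, hmem, ha⟩ := ν.mem_search h (l := ν.code.deadlocks)
      fun g hg => (ν.mem_deadlocks_code.1 hg).imp fun _ h => h.2
    refine ⟨!answer, Part.mem_map not hmem, ?_⟩
    have : (∃ G, P.Reachable G ∧ ν.codeGlobal G ∈ ν.code.deadlocks) ↔ ¬ P.DeadlockFree := by
      simp [CFSM.Protocol.DeadlockFree, ν.mem_deadlocks_code, ν.codeGlobal_injective.eq_iff]
    rw [this] at ha
    cases answer <;> simp_all
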